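/- Let $x(z)=z+1/z$ on $\mathbb{P}^1$, with branch points $\alpha=\pm1$ and local involution $z\mapsto\hat z=1/z$, and let $y$ be a function analytic near $z=1$ and $z=-1$ with $y'(\pm1)\neq0$. The Eynard--Orantin invariants $\omega^g_n$ ($g\ge0$, $n\ge1$) of the curve $(x,y)$ are defined by $\omega^0_1=y\,dx$, $\omega^0_2(w,z)=B(w,z)=\frac{dw\,dz}{(w-z)^2}$ and, for $2g-2+(n+1)>0$ and $S=\{1,\dots,n\}$, $$\omega^g_{n+1}(z_0,z_S)=\sum_{\alpha=\pm1}\operatorname*{Res}_{z=\alpha}K(z_0,z)\Big[\omega^{g-1}_{n+2}(z,\hat z,z_S)+\sum_{\substack{g_1+g_2=g\\ I\sqcup J=S}}{}^{'}\ \omega^{g_1}_{|I|+1}(z,z_I)\,\omega^{g_2}_{|J|+1}(\hat z,z_J)\Big],\qquad K(z_0,z)=\frac{-\int_{\hat z}^{z}B(z_0,z')}{2\,(y(z)-y(\hat z))\,dx(z)},$$ where $\omega^{-1}_{n+2}=0$ and the primed sum omits the terms with $(g_1,I)=(0,\emptyset)$ or $(g_2,J)=(0,\emptyset)$. For $g\ge2$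 the symplectic invariant $F^g$ is defined by $$\sum_{\alpha=\pm1}\operatorname*{Res}_{z=\alpha}\Phi(z)\,\omega^g_1(z)=(2g-2)F^g,$$ where $\Phi$ is any function with $d\Phi=y\,dx$ near $z=1$ and near $z=-1$. For $M\ge0$ let $y^{(M)}(z)=\sum_{k=0}^M(a_k+zb_k)(1-z^2)^k$ be the polynomials, with $a_k,b_k\in\mathbb{C}$ independent of $M$, that agree with $y$ at $z=\pm1$ up to the $M$-th derivatives. For a polynomial $p(z)=\sum_i p_iz^i$ and a function $f$ on $\mathbb{Z}$ put $p(\mathcal{D})\{f(m)\}_{m=a}=\sum_i p_if(a+i)$, where $\mathcal{D}f(m)=f(m+1)$. Then for every $g\ge2$: (1) There is a unique function $N^g_1:\mathbb{Z}\to\mathbb{C}$ that is given by one polynomial on the even integers and by one polynomial on the odd integers, and that satisfies $\omega^g_1(z)=\frac{d}{dz}\Big(\sum_{b>0}N^g_1(b)z^b\Big)dz$ near $z=0$; and $$F^g=\frac{1}{2-2g}\,(1-\mathcal{D}^2)\,y(\mathcal{D})\{N^g_1(m)\}_{m=-1},$$ where $y(\mathcal{D})$ stands for $y^{(M)}(\mathcal{D})$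 with any sufficiently large $M$ (that is, the equality holds for all sufficiently large $M$). (2) In particular, for $y=z^m/m$ with $m=1,2,\dots$, $$F^g=\frac{N^g_1(m+1)-N^g_1(m-1)}{m(2g-2)}.$$ -/

import Mathlib

open Filter Topology Polynomial

noncomputable section

namespace EynardOrantin

/-- The function `x(z) = z + 1/z` on `ℙ¹`; its branch points are `z = 1` and `z = -1`. -/
def xFun (z : ℂ) : ℂ := z + z⁻¹

/-- `x'(z)`, the coefficient of `dx(z)`. -/
def dx (z : ℂ) : ℂ := deriv xFun z

/-- The involution `z ↦ ẑ = 1/z`, for which `x(ẑ) = x(z)`, near each branch point. -/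
def hat (z : ℂ) : ℂ := z⁻¹

/-- The residue at `a` of `f(z) dz`, for `f` meromorphic at `a`: the value of
`(2πi)⁻¹ ∮ f(z) dz` over small circles around `a`. -/
def residue (f : ℂ → ℂ) (a : ℂ) : ℂ :=
  limUnder (𝓝[>] (0 : ℝ)) fun r : ℝ =>
    (2 * (Real.pi : ℂ) * Complex.I)⁻¹ * ∮ z in C(a, r), f z

/-- The coefficient of the Bergmann kernel `B(w,z) = dw dz / (w - z)²` of `ℙ¹`. -/
def bergmann (w z : ℂ) : ℂ := 1 / (w - z) ^ 2

/-- `∫_{ẑ}^z B(z₀, z')`, as the increment of the primitive `z' ↦ 1 / (z₀ - z')`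
of `z' ↦ B(z₀, z')`. -/
def bergmannInt (z₀ z : ℂ) : ℂ := 1 / (z₀ - z) - 1 / (z₀ - hat z)

theorem hasDerivAt_bergmann_primitive (z₀ z : ℂ) (h : z₀ ≠ z) :
    HasDerivAt (fun z' : ℂ => 1 / (z₀ - z')) (bergmann z₀ z) z := by
  have h0 : z₀ - z ≠ 0 := sub_ne_zero.mpr h
  have h1 : HasDerivAt (fun z' : ℂ => z₀ - z') (-1) z := by
    simpa using (hasDerivAt_id z).const_sub z₀
  have h2 : HasDerivAt (fun z' : ℂ => 1 / (z₀ - z'))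
      ((0 * (z₀ - z) - 1 * (-1)) / (z₀ - z) ^ 2) z :=
    (hasDerivAt_const z (1 : ℂ)).div h1 h0
  have h3 : (0 * (z₀ - z) - 1 * (-1)) / (z₀ - z) ^ 2 = bergmann z₀ z := by
    simp [bergmann]
  rwa [h3] at h2

/-- The coefficient (of `dz₀ / dz`) of the recursion kernel
`K(z₀,z) = -∫_{ẑ}^z B(z₀,z') / (2 (y(z) - y(ẑ)) dx(z))`. -/
def kernel (y : ℂ → ℂ) (z₀ z : ℂ) : ℂ :=
  -bergmannInt z₀ z / (2 * (y z - y (hat z)) * dx z)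

/-- The sub-tuple `z_I` of a tuple `z`, in increasing order of the indices. -/
def subTuple {n : ℕ} (z : Fin n → ℂ) (I : Finset (Fin n)) : Fin I.card → ℂ :=
  fun i => z (I.orderEmbOfFin rfl i)

/-- The Eynard-Orantin invariants of the curve `x = z + 1/z`, `y = y(z)`:
`omega y g n z` is the coefficient of `dz₁ ⋯ dz_n` in `ω^g_n(z₁, …, z_n)`.
A form evaluated at `ẑ` is pulled back along `z ↦ ẑ`, whence the factor `deriv hat z`.
The sum runs over `g₁ + g₂ = g` and `I ⊔ J = S`, without the terms that contain `ω^0_1`.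
The value for `n = 0` is a placeholder; the invariants with `n = 0` are defined separately. -/
def omega (y : ℂ → ℂ) : (g n : ℕ) → (Fin n → ℂ) → ℂ
  | _, 0, _ => 0
  | 0, 1, z => y (z 0) * dx (z 0)
  | 0, 2, z => bergmann (z 0) (z 1)
  | g, n + 1, z =>
    ∑ α ∈ ({1, -1} : Finset ℂ), residue (fun t : ℂ =>
      kernel y (z 0) t *
        ((if _h : 1 ≤ g then
            omega y (g - 1) (n + 2) (Fin.cons t (Fin.cons (hat t) (Fin.tail z)))
          else 0) +
          ∑ g₁ : Fin (g + 1), ∑ I : Finset (Fin n),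
            if _h : ((g₁ : ℕ) = 0 ∧ I.card = 0) ∨ (g - (g₁ : ℕ) = 0 ∧ Iᶜ.card = 0) then 0
            else
              omega y (g₁ : ℕ) (I.card + 1) (Fin.cons t (subTuple (Fin.tail z) I)) *
                omega y (g - (g₁ : ℕ)) (Iᶜ.card + 1)
                  (Fin.cons (hat t) (subTuple (Fin.tail z) Iᶜ))) *
        deriv hat t) α
termination_by g n => 2 * g + n
decreasing_by
  · omega
  · have h1 := Finset.card_add_card_compl I
    have h2 := g₁.isLt
    simp only [Fintype.card_fin] at h1
    omega
  · have h1 := Finset.card_add_card_compl I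
    have h2 := g₁.isLt
    simp only [Fintype.card_fin] at h1
    omega

/-- `Φ` is a primitive of `y dx` near each of the two branch points. -/
def IsLocalPrimitive (y Φ : ℂ → ℂ) : Prop :=
  ∀ α ∈ ({1, -1} : Finset ℂ), ∀ᶠ z in 𝓝 α, HasDerivAt Φ (y z * dx z) z

theorem exists_isLocalPrimitive (y : ℂ → ℂ) (h₁ : AnalyticAt ℂ y 1)
    (h₂ : AnalyticAt ℂ y (-1)) : ∃ Φ, IsLocalPrimitive y Φ := by
  have key : ∀ α : ℂ, α ≠ 0 → AnalyticAt ℂ y α →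
      ∃ Φ : ℂ → ℂ, ∀ᶠ z in 𝓝 α, HasDerivAt Φ (y z * dx z) z := by
    intro α hα hy
    have hx : AnalyticAt ℂ xFun α := analyticAt_id.add (analyticAt_inv hα)
    have hf : AnalyticAt ℂ (fun z => y z * dx z) α := hy.mul hx.deriv
    obtain ⟨r, hr, hball⟩ :=
      Metric.eventually_nhds_iff_ball.mp hf.eventually_analyticAt
    have hd : DifferentiableOn ℂ (fun z => y z * dx z) (Metric.ball α r) :=
      fun z hz => (hball z hz).differentiableAt.differentiableWithinAt
    obtain ⟨Φ, hΦ⟩ := hd.isExactOn_ball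
    exact ⟨Φ, Metric.eventually_nhds_iff_ball.mpr ⟨r, hr, hΦ⟩⟩
  obtain ⟨Φ₁, hΦ₁⟩ := key 1 one_ne_zero h₁
  obtain ⟨Φ₂, hΦ₂⟩ := key (-1) (by simp) h₂
  have hU₁ : {z : ℂ | 0 < z.re} ∈ 𝓝 (1 : ℂ) :=
    (isOpen_lt continuous_const Complex.continuous_re).mem_nhds (by simp)
  have hU₂ : {z : ℂ | z.re < 0} ∈ 𝓝 (-1 : ℂ) :=
    (isOpen_lt Complex.continuous_re continuous_const).mem_nhds (by simp)
  classical
  refine ⟨fun z => if 0 < z.re then Φ₁ z else Φ₂ z, ?_⟩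
  intro α hα
  simp only [Finset.mem_insert, Finset.mem_singleton] at hα
  rcases hα with rfl | rfl
  · filter_upwards [hΦ₁, eventually_eventually_nhds.mpr hU₁] with z hz hz'
    refine hz.congr_of_eventuallyEq ?_
    filter_upwards [hz'] with w hw
    exact if_pos hw
  · filter_upwards [hΦ₂, eventually_eventually_nhds.mpr hU₂] with z hz hz'
    refine hz.congr_of_eventuallyEq ?_
    filter_upwards [hz'] with w hw
    exact if_neg (not_lt.mpr (le_of_lt hw))

/-- The symplectic invariant `F^g` of the curve `x = z + 1/z`, `y = y(z)` for `g ≥ 2`, defined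
by `∑_α Res_{z=α} Φ(z) ω^g_1(z) = (2g-2) F^g`, for a local primitive `Φ` of `y dx`. -/
def symplecticInvariant (y Φ : ℂ → ℂ) (g : ℕ) : ℂ :=
  (∑ α ∈ ({1, -1} : Finset ℂ), residue (fun z : ℂ => Φ z * omega y g 1 ![z]) α) /
    (2 * (g : ℂ) - 2)

/-- A quasi-polynomial on `ℤ`: a polynomial on the even and one on the odd integers. -/
def IsQuasiPolynomial (f : ℤ → ℂ) : Prop :=
  ∃ p q : ℂ[X], ∀ n : ℤ, f n = if Even n then p.eval (n : ℂ) else q.eval (n : ℂ)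

/-- `N` is the function `N^g_1`: the quasi-polynomial on `ℤ` whose values at positive integers
are given by the expansion `ω^g_1(z) = d/dz (∑_{b>0} N(b) z^b) dz` around `z = 0`. -/
structure IsN (y : ℂ → ℂ) (g : ℕ) (N : ℤ → ℂ) : Prop where
  quasi : IsQuasiPolynomial N
  expansion : ∀ᶠ z in 𝓝 (0 : ℂ),
    HasSum (fun b : ℕ => ((b : ℂ) + 1) * N ((b : ℤ) + 1) * z ^ b) (omega y g 1 ![z])

/-- `p(𝓓){f(n)}_{n=a} = ∑ p_i f(a+i)` for a polynomial `p`, where `𝓓 f(n) = f(n+1)`. -/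
def applyShift (p : ℂ[X]) (f : ℤ → ℂ) (a : ℤ) : ℂ :=
  p.sum fun i c => c * f (a + (i : ℤ))

/-- If `p` agrees with `y` at `ε = ±1` up to the derivatives of order `< k`, this is the value
that `a + ε b` must have for `p + (a + z b)(1 - z²)^k` to agree with `y` at `ε` up to order `k`,
since the `k`-th derivative of `(a + z b)(1 - z²)^k` at `ε` is `(a + ε b) k! (-2ε)^k`. -/
def nextCoeff (y : ℂ → ℂ) (p : ℂ[X]) (k : ℕ) (ε : ℂ) : ℂ :=
  (iteratedDeriv k y ε - (derivative^[k] p).eval ε) / ((k.factorial : ℂ) * (-2 * ε) ^ k)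

/-- The term `(a + z b)(1 - z²)^k` that corrects `p` at order `k`. -/
def nextTerm (y : ℂ → ℂ) (p : ℂ[X]) (k : ℕ) : ℂ[X] :=
  (C ((nextCoeff y p k 1 + nextCoeff y p k (-1)) / 2) +
    X * C ((nextCoeff y p k 1 - nextCoeff y p k (-1)) / 2)) * (1 - X ^ 2) ^ k

/-- The partial sums `y^{(M)}(z) = ∑_{k=0}^M (a_k + z b_k)(1 - z²)^k` that agree with `y` at
`z = ±1` up to the `M`-th derivatives (see `partialSum_agrees`). -/
def partialSum (y : ℂ → ℂ) : ℕ → ℂ[X]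
  | 0 => nextTerm y 0 0
  | k + 1 => partialSum y k + nextTerm y (partialSum y k) (k + 1)

theorem eval_iterate_derivative_mul_pow (B : ℂ[X]) (ε : ℂ) (j k : ℕ) (hjk : j ≤ k) :
    (derivative^[j] (B * (X - C ε) ^ k)).eval ε
      = if j = k then (k.factorial : ℂ) * B.eval ε else 0 := by
  have h1 : (derivative^[j] (B * (X - C ε) ^ k)).eval ε
      = (j.factorial : ℂ) * (taylor ε (B * (X - C ε) ^ k)).coeff j := by
    rw [taylor_coeff, ← factorial_smul_hasseDeriv]
    simp
  have h2 : taylor ε (B * (X - C ε) ^ k) = taylor ε B * X ^ k := by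
    simp [taylor_mul, taylor_pow]
  rw [h1, h2, coeff_mul_X_pow']
  rcases Nat.lt_or_ge j k with h | h
  · simp [not_le.mpr h, h.ne]
  · have : j = k := le_antisymm hjk h
    subst this
    simp

theorem eval_iterate_derivative_nextTerm (y : ℂ → ℂ) (p : ℂ[X]) (j k : ℕ) (hjk : j ≤ k)
    (ε : ℂ) (hε : ε = 1 ∨ ε = -1) :
    (derivative^[j] (nextTerm y p k)).eval ε
      = if j = k then iteratedDeriv k y ε - (derivative^[k] p).eval ε else 0 := by
  have hsq : C ε * C ε = (1 : ℂ[X]) := by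
    rw [← C_mul, ← C_1]
    congr 1
    rcases hε with rfl | rfl <;> norm_num
  have hfac : (1 - X ^ 2 : ℂ[X]) = -(X + C ε) * (X - C ε) := by
    linear_combination -hsq
  unfold nextTerm
  rw [hfac, mul_pow, ← mul_assoc, eval_iterate_derivative_mul_pow _ _ _ _ hjk]
  split_ifs with h
  · have hk : (k.factorial : ℂ) ≠ 0 := Nat.cast_ne_zero.mpr k.factorial_ne_zero
    rcases hε with rfl | rfl
    · have h2 : ((-2 : ℂ)) ^ k ≠ 0 := pow_ne_zero _ (by norm_num)
      simp only [nextCoeff, eval_mul, eval_add, eval_C, eval_X, eval_pow, eval_neg]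
      norm_num
      field_simp
      ring
    · have h2 : ((2 : ℂ)) ^ k ≠ 0 := pow_ne_zero _ (by norm_num)
      simp only [nextCoeff, eval_mul, eval_add, eval_C, eval_X, eval_pow, eval_neg]
      norm_num
      field_simp
      ring
  · rfl

theorem partialSum_agrees (y : ℂ → ℂ) (M k : ℕ) (hk : k ≤ M)
    (ε : ℂ) (hε : ε = 1 ∨ ε = -1) :
    (derivative^[k] (partialSum y M)).eval ε = iteratedDeriv k y ε := by
  induction M with
  | zero =>
    obtain rfl : k = 0 := by omega
    rw [partialSum, eval_iterate_derivative_nextTerm y 0 0 0 le_rfl ε hε]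
    simp
  | succ M ih =>
    rw [partialSum, iterate_map_add, eval_add,
      eval_iterate_derivative_nextTerm y _ k (M + 1) hk ε hε]
    rcases Nat.lt_or_ge k (M + 1) with h | h
    · rw [ih (by omega), if_neg h.ne, add_zero]
    · obtain rfl : k = M + 1 := by omega
      simp

end EynardOrantin

end

noncomputable section

namespace EynardOrantin

/-! ### Residues -/

/-! Everything rests on the linear functional Λ(f) = Σ_α Res_{z=α} F ω^g_1 with dF = f near each
branch point (`polarFunctional`). It is well defined because ω^g_1 has no simple-pole terms, so the
local constants of F do not matter.

The recursion writes ω^g_1(z) as Σ_α Res_{t=α} (1/(z-t) - 1/(z-t̂)) G(t), with G meromorphic at ±1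
and independent of z. To know that G is meromorphic one shows, by induction on 2g+n, that every
stable ω^g_n is a polynomial in the 1/(z_i ∓ 1) (`omega_mem_poleAlgebra`). For any F analytic at ±1
the residues of (F(t) - F(t̂)) G(t) are fixed finite combinations of Taylor coefficients of F
(`exists_residue_sub_comp_hat_eq`). Taking F = 1/(z-t) gives the principal parts of ω^g_1; taking F
invariant under t ↦ t̂ gives Λ(F') = 0 (`exists_polar_form`).

Put N(b) = Λ(s^(-b-1)). Expanding the principal parts at 0 shows that this is N^g_1
(`isN_polarQuasiPolynomial`), and Λ(F') = 0 for F = s^b + s^(-b) makes N even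
(`polarQuasiPolynomial_neg`). As dx = (1 - s^(-2)) ds, Λ(s^n dx/ds) = N(-n-1) - N(1-n) = N(n+1) -
N(n-1), which gives the formula for polynomial y by linearity. A general y may be replaced by
`partialSum y M`, since Λ sees only finitely many derivatives at ±1. -/

theorem eventually_forall_sphere {p : ℂ → Prop} {a : ℂ} (h : ∀ᶠ t in 𝓝[≠] a, p t) :
    ∀ᶠ r : ℝ in 𝓝[>] 0, 0 < r ∧ ∀ t ∈ Metric.sphere a r, p t := by
  obtain ⟨ε, hε, hp⟩ := Metric.mem_nhdsWithin_iff.mp h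
  filter_upwards [Ioo_mem_nhdsGT hε] with r hr
  refine ⟨hr.1, fun t ht => hp ⟨?_, ?_⟩⟩
  · rw [Metric.mem_ball, Metric.mem_sphere.mp ht]
    exact hr.2
  · exact Metric.ne_of_mem_sphere ht hr.1.ne'

/-- Cauchy's formula for derivatives: the circle integral is constant for small r, so the limit that
defines `residue` exists and is a Taylor coefficient of h. -/
theorem eventually_circleIntegral_eq {f h : ℂ → ℂ} {a : ℂ} {m : ℕ} (hh : AnalyticAt ℂ h a)
    (hf : ∀ᶠ t in 𝓝[≠] a, (t - a) ^ (m + 1) * f t = h t) :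
    ∀ᶠ r : ℝ in 𝓝[>] 0, (2 * (Real.pi : ℂ) * Complex.I)⁻¹ * ∮ z in C(a, r), f z
      = iteratedDeriv m h a / m.factorial := by
  obtain ⟨ε, hε, hball⟩ := Metric.eventually_nhds_iff_ball.mp hh.eventually_analyticAt
  filter_upwards [eventually_forall_sphere hf, Ioo_mem_nhdsGT hε] with r hr hr'
  have hd : DifferentiableOn ℂ h (Metric.closedBall a r) := fun z hz =>
    (hball z (Metric.closedBall_subset_ball hr'.2 hz)).differentiableAt.differentiableWithinAt
  have h1 : (∮ z in C(a, r), f z) = ∮ z in C(a, r), (1 / (z - a) ^ (m + 1)) • h z := by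
    refine circleIntegral.integral_congr hr.1.le fun t ht => ?_
    have hne : t - a ≠ 0 := sub_ne_zero.mpr (Metric.ne_of_mem_sphere ht hr.1.ne')
    simp only [smul_eq_mul]
    rw [← hr.2 t ht]
    field_simp
  rw [h1, hd.circleIntegral_one_div_sub_center_pow_smul hr.1 m, smul_eq_mul]
  have := Complex.two_pi_I_ne_zero
  field_simp

theorem residue_eq_of_eventually {f : ℂ → ℂ} {a c : ℂ}
    (h : ∀ᶠ r : ℝ in 𝓝[>] 0, (2 * (Real.pi : ℂ) * Complex.I)⁻¹ * ∮ z in C(a, r), f z = c) :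
    residue f a = c :=
  (tendsto_const_nhds.congr' (h.mono fun _ hr => hr.symm)).limUnder_eq

theorem residue_eq_iteratedDeriv {f h : ℂ → ℂ} {a : ℂ} {m : ℕ} (hh : AnalyticAt ℂ h a)
    (hf : ∀ᶠ t in 𝓝[≠] a, (t - a) ^ (m + 1) * f t = h t) :
    residue f a = iteratedDeriv m h a / m.factorial :=
  residue_eq_of_eventually (eventually_circleIntegral_eq hh hf)

theorem _root_.MeromorphicAt.exists_pow_succ_mul {f : ℂ → ℂ} {a : ℂ} (hf : MeromorphicAt f a) :
    ∃ (m : ℕ) (h : ℂ → ℂ), AnalyticAt ℂ h a ∧ ∀ t, (t - a) ^ (m + 1) * f t = h t := by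
  obtain ⟨n, hn⟩ := hf
  refine ⟨n, fun t => (t - a) * ((t - a) ^ n • f t),
    (analyticAt_id.sub analyticAt_const).mul hn, fun t => ?_⟩
  simp only [smul_eq_mul]
  ring

theorem eventually_circleIntegral_eq_residue {f : ℂ → ℂ} {a : ℂ} (hf : MeromorphicAt f a) :
    ∀ᶠ r : ℝ in 𝓝[>] 0,
      (2 * (Real.pi : ℂ) * Complex.I)⁻¹ * ∮ z in C(a, r), f z = residue f a := by
  obtain ⟨m, h, hh, hfh⟩ := hf.exists_pow_succ_mul
  have := eventually_circleIntegral_eq hh (Eventually.of_forall hfh)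
  rwa [← residue_eq_of_eventually this] at this

theorem eventually_circleIntegrable {f : ℂ → ℂ} {a : ℂ} (hf : MeromorphicAt f a) :
    ∀ᶠ r : ℝ in 𝓝[>] 0, CircleIntegrable f a r := by
  filter_upwards [eventually_forall_sphere hf.eventually_analyticAt] with r hr
  exact ContinuousOn.circleIntegrable hr.1.le
    fun t ht => (hr.2 t ht).continuousAt.continuousWithinAt

/-- No meromorphy is needed: the integrals agree for all small r, so the two `limUnder` terms are
equal even if there is no limit. -/
theorem residue_congr {f g : ℂ → ℂ} {a : ℂ} (h : f =ᶠ[𝓝[≠] a] g) :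
    residue f a = residue g a := by
  unfold residue limUnder
  congr 1
  refine Filter.map_congr ?_
  filter_upwards [eventually_forall_sphere h] with r hr
  rw [circleIntegral.integral_congr hr.1.le hr.2]

theorem residue_of_analyticAt {f : ℂ → ℂ} {a : ℂ} (hf : AnalyticAt ℂ f a) :
    residue f a = 0 := by
  have h : AnalyticAt ℂ (fun t => (t - a) * f t) a :=
    (analyticAt_id.sub analyticAt_const).mul hf
  rw [residue_eq_iteratedDeriv (m := 0) h (Eventually.of_forall fun t => by simp)]
  simp

theorem residue_add {f g : ℂ → ℂ} {a : ℂ} (hf : MeromorphicAt f a) (hg : MeromorphicAt g a) :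
    residue (fun t => f t + g t) a = residue f a + residue g a := by
  refine residue_eq_of_eventually ?_
  filter_upwards [eventually_circleIntegral_eq_residue hf, eventually_circleIntegral_eq_residue hg,
    eventually_circleIntegrable hf, eventually_circleIntegrable hg] with r h1 h2 h3 h4
  rw [circleIntegral.integral_add h3 h4, mul_add, h1, h2]

theorem residue_const_mul {f : ℂ → ℂ} {a : ℂ} (c : ℂ) (hf : MeromorphicAt f a) :
    residue (fun t => c * f t) a = c * residue f a := by
  refine residue_eq_of_eventually ?_
  filter_upwards [eventually_circleIntegral_eq_residue hf] with r h1
  rw [circleIntegral.integral_const_mul, ← h1]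
  ring

theorem residue_sum {ι : Type*} (s : Finset ι) {f : ι → ℂ → ℂ} {a : ℂ}
    (hf : ∀ i ∈ s, MeromorphicAt (f i) a) :
    residue (fun t => ∑ i ∈ s, f i t) a = ∑ i ∈ s, residue (f i) a := by
  classical
  induction s using Finset.induction_on with
  | empty => simpa using residue_of_analyticAt (f := fun _ => 0) (a := a) analyticAt_const
  | insert i s hi ih =>
    simp only [Finset.sum_insert hi]
    rw [residue_add (hf i (by simp)) (MeromorphicAt.fun_sum fun j hj => hf j (by simp [hj])),
      ih fun j hj => hf j (by simp [hj])]

theorem exists_eq_taylor_add {f : ℂ → ℂ} {a : ℂ} (hf : AnalyticAt ℂ f a) (n : ℕ) :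
    ∃ F : ℂ → ℂ, AnalyticAt ℂ F a ∧ ∀ t,
      f t = (∑ i ∈ Finset.range n, iteratedDeriv i f a / i.factorial * (t - a) ^ i)
        + (t - a) ^ n * F t := by
  have hg : AnalyticAt ℂ (fun s => f (a + s)) 0 := by
    have : AnalyticAt ℂ f ((fun s : ℂ => a + s) 0) := by simpa using hf
    exact this.comp (f := fun s : ℂ => a + s) (by fun_prop)
  obtain ⟨F, hF, h⟩ := hg.exists_eq_sum_add_pow_mul n
  refine ⟨fun t => F (t - a), ?_, fun t => ?_⟩
  · have : AnalyticAt ℂ F ((fun s : ℂ => s - a) a) := by simpa using hF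
    exact this.comp (f := fun s : ℂ => s - a) (by fun_prop)
  · have := h (t - a)
    simp only [add_sub_cancel, smul_eq_mul, iteratedDeriv_comp_const_add, add_zero] at this
    rw [this]
    congr 1
    exact Finset.sum_congr rfl fun i _ => by ring

theorem residue_mul_inv_pow {f : ℂ → ℂ} {a : ℂ} (hf : AnalyticAt ℂ f a) (m : ℕ) :
    residue (fun t => f t * ((t - a) ^ (m + 1))⁻¹) a = iteratedDeriv m f a / m.factorial := by
  refine residue_eq_iteratedDeriv hf ?_
  filter_upwards [self_mem_nhdsWithin] with t ht
  have : t - a ≠ 0 := sub_ne_zero.mpr ht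
  field_simp

/-! ### Functions with poles on the branch points only -/

/-- The tuples none of whose entries is a branch point. -/
def regularSet (n : ℕ) : Set (Fin n → ℂ) := {z | ∀ i, z i ≠ 1 ∧ z i ≠ -1}

/-- The functions that agree on `regularSet n` with a polynomial in the `1 / (z i ∓ 1)`. -/
def poleAlgebra (n : ℕ) : Subalgebra ℂ ((Fin n → ℂ) → ℂ) :=
  Algebra.adjoin ℂ
    ({f | ∃ (i : Fin n) (β : ℂ), (β = 1 ∨ β = -1) ∧ f = fun z => (z i - β)⁻¹} ∪
      {f | Set.EqOn f 0 (regularSet n)})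

theorem inv_sub_mem_poleAlgebra {n : ℕ} (i : Fin n) {β : ℂ} (hβ : β = 1 ∨ β = -1) :
    (fun z : Fin n → ℂ => (z i - β)⁻¹) ∈ poleAlgebra n :=
  Algebra.subset_adjoin (Or.inl ⟨i, β, hβ, rfl⟩)

theorem const_mem_poleAlgebra (n : ℕ) (c : ℂ) : (fun _ : Fin n → ℂ => c) ∈ poleAlgebra n :=
  (poleAlgebra n).algebraMap_mem c

theorem sum_mem_poleAlgebra {n : ℕ} {ι : Type*} (s : Finset ι) {f : ι → (Fin n → ℂ) → ℂ}
    (hf : ∀ i ∈ s, f i ∈ poleAlgebra n) : (fun z => ∑ i ∈ s, f i z) ∈ poleAlgebra n := by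
  have : (fun z => ∑ i ∈ s, f i z) = ∑ i ∈ s, f i := by
    ext z
    simp
  rw [this]
  exact Subalgebra.sum_mem _ hf

/-- This is what the second kind of generator is for: the values at tuples with a branch point as an
entry are irrelevant. -/
theorem poleAlgebra_congr {n : ℕ} {f g : (Fin n → ℂ) → ℂ} (hf : f ∈ poleAlgebra n)
    (h : ∀ z ∈ regularSet n, g z = f z) : g ∈ poleAlgebra n := by
  have h0 : g - f ∈ poleAlgebra n :=
    Algebra.subset_adjoin (Or.inr fun z hz => by simp [h z hz])
  simpa using (poleAlgebra n).add_mem h0 hf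

/-! ### Families of functions analytic or meromorphic at a point -/

/-- A family of functions of `t` analytic at `α` whose Taylor coefficients are in
`poleAlgebra n`, as functions of the parameters. -/
def AnalyticFamily (α : ℂ) {n : ℕ} (h : ℂ → (Fin n → ℂ) → ℂ) : Prop :=
  (∀ z ∈ regularSet n, AnalyticAt ℂ (fun t => h t z) α) ∧
    ∀ k, (fun z => iteratedDeriv k (fun t => h t z) α) ∈ poleAlgebra n

/-- A family of functions of `t` meromorphic at `α`, with poles of bounded order, whose Laurent
coefficients are in `poleAlgebra n`, as functions of the parameters. -/
def MeromorphicFamily (α : ℂ) {n : ℕ} (H : ℂ → (Fin n → ℂ) → ℂ) : Prop :=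
  ∃ (m : ℕ) (h : ℂ → (Fin n → ℂ) → ℂ), AnalyticFamily α h ∧
    ∀ z ∈ regularSet n, ∀ᶠ t in 𝓝[≠] α, (t - α) ^ (m + 1) * H t z = h t z

variable {α : ℂ} {n : ℕ}

theorem AnalyticFamily.add {h₁ h₂ : ℂ → (Fin n → ℂ) → ℂ} (H₁ : AnalyticFamily α h₁)
    (H₂ : AnalyticFamily α h₂) : AnalyticFamily α fun t z => h₁ t z + h₂ t z := by
  refine ⟨fun z hz => (H₁.1 z hz).add (H₂.1 z hz), fun k => ?_⟩
  refine poleAlgebra_congr ((poleAlgebra n).add_mem (H₁.2 k) (H₂.2 k)) fun z hz => ?_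
  exact iteratedDeriv_fun_add (H₁.1 z hz).contDiffAt (H₂.1 z hz).contDiffAt

theorem AnalyticFamily.mul {h₁ h₂ : ℂ → (Fin n → ℂ) → ℂ} (H₁ : AnalyticFamily α h₁)
    (H₂ : AnalyticFamily α h₂) : AnalyticFamily α fun t z => h₁ t z * h₂ t z := by
  refine ⟨fun z hz => (H₁.1 z hz).mul (H₂.1 z hz), fun k => ?_⟩
  refine poleAlgebra_congr (sum_mem_poleAlgebra (Finset.range (k + 1)) fun i _ =>
    (poleAlgebra n).mul_mem ((poleAlgebra n).mul_mem (const_mem_poleAlgebra n (k.choose i))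
      (H₁.2 i)) (H₂.2 (k - i))) fun z hz => ?_
  exact iteratedDeriv_fun_mul (H₁.1 z hz).contDiffAt (H₂.1 z hz).contDiffAt

theorem AnalyticFamily.of_analyticAt {u : ℂ → ℂ} (hu : AnalyticAt ℂ u α) :
    AnalyticFamily α fun t (_ : Fin n → ℂ) => u t :=
  ⟨fun _ _ => hu, fun _ => const_mem_poleAlgebra n _⟩

theorem AnalyticFamily.of_mem {f : (Fin n → ℂ) → ℂ} (hf : f ∈ poleAlgebra n) :
    AnalyticFamily α fun _ z => f z := by
  refine ⟨fun _ _ => analyticAt_const, fun k => ?_⟩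
  simp only [iteratedDeriv_const]
  split_ifs
  · exact hf
  · exact (poleAlgebra n).zero_mem

/-- Since u α = α, the value at t = α is a generator. The higher coefficients follow recursively
from Leibniz's rule applied to (z_j - u)⁻¹ (z_j - u) = 1. -/
theorem AnalyticFamily.inv_sub (hα : α = 1 ∨ α = -1) (j : Fin n) {u : ℂ → ℂ}
    (hu : AnalyticAt ℂ u α) (hu' : u α = α) :
    AnalyticFamily α fun t (z : Fin n → ℂ) => (z j - u t)⁻¹ := by
  have hne : ∀ z ∈ regularSet n, z j - u α ≠ 0 := by
    intro z hz
    rw [hu', sub_ne_zero]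
    rcases hα with rfl | rfl
    exacts [(hz j).1, (hz j).2]
  have hf : ∀ z : Fin n → ℂ, AnalyticAt ℂ (fun t => z j - u t) α :=
    fun z => analyticAt_const.sub hu
  have hg : ∀ z ∈ regularSet n, AnalyticAt ℂ (fun t => (z j - u t)⁻¹) α :=
    fun z hz => (hf z).fun_inv (hne z hz)
  refine ⟨hg, fun k => ?_⟩
  induction k using Nat.strong_induction_on with
  | _ k ih =>
    rcases Nat.eq_zero_or_pos k with rfl | hk
    · simpa [hu'] using inv_sub_mem_poleAlgebra j hα
    · refine poleAlgebra_congr ((poleAlgebra n).mul_mem (inv_sub_mem_poleAlgebra j hα)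
        (sum_mem_poleAlgebra (Finset.range k) fun i hi =>
          (poleAlgebra n).mul_mem ((poleAlgebra n).mul_mem
            (const_mem_poleAlgebra n (k.choose i)) (ih i (Finset.mem_range.mp hi)))
            (const_mem_poleAlgebra n (iteratedDeriv (k - i) u α)))) fun z hz => ?_
      have h1 : iteratedDeriv k (fun t => (z j - u t)⁻¹ * (z j - u t)) α = 0 := by
        have : (fun t => (z j - u t)⁻¹ * (z j - u t)) =ᶠ[𝓝 α] fun _ => 1 := by
          filter_upwards [(hf z).continuousAt.eventually_ne (hne z hz)] with t ht
          exact inv_mul_cancel₀ ht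
        rw [this.iteratedDeriv_eq, iteratedDeriv_const, if_neg hk.ne']
      rw [iteratedDeriv_fun_mul (hg z hz).contDiffAt (hf z).contDiffAt,
        Finset.sum_range_succ] at h1
      have h2 : ∀ i ∈ Finset.range k, (k.choose i : ℂ) *
          iteratedDeriv i (fun t => (z j - u t)⁻¹) α *
            iteratedDeriv (k - i) (fun t => z j - u t) α = -((k.choose i : ℂ) *
          iteratedDeriv i (fun t => (z j - u t)⁻¹) α * iteratedDeriv (k - i) u α) := by
        intro i hi
        have := Finset.mem_range.mp hi
        rw [iteratedDeriv_const_sub (by omega)]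
        simp
      rw [Finset.sum_congr rfl h2, Finset.sum_neg_distrib] at h1
      have h3 := hne z hz
      simp only [Nat.choose_self, Nat.cast_one, one_mul, Nat.sub_self, iteratedDeriv_zero] at h1
      rw [hu'] at h1 h3
      simp only [Pi.mul_apply]
      rw [eq_inv_mul_iff_mul_eq₀ h3]
      linear_combination h1

theorem AnalyticFamily.meromorphicFamily {h : ℂ → (Fin n → ℂ) → ℂ} (H : AnalyticFamily α h) :
    MeromorphicFamily α h :=
  ⟨0, _, (AnalyticFamily.of_analyticAt (u := fun t => (t - α) ^ (0 + 1)) (by fun_prop)).mul H,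
    fun _ _ => Eventually.of_forall fun _ => rfl⟩

theorem MeromorphicFamily.of_meromorphicAt {u : ℂ → ℂ} (hu : MeromorphicAt u α) :
    MeromorphicFamily α fun t (_ : Fin n → ℂ) => u t := by
  obtain ⟨m, h, hh, hm⟩ := hu.exists_pow_succ_mul
  exact ⟨m, _, AnalyticFamily.of_analyticAt hh, fun _ _ => Eventually.of_forall hm⟩

theorem MeromorphicFamily.congr {H₁ H₂ : ℂ → (Fin n → ℂ) → ℂ} (h : MeromorphicFamily α H₁)
    (he : ∀ z ∈ regularSet n, ∀ᶠ t in 𝓝[≠] α, H₂ t z = H₁ t z) : MeromorphicFamily α H₂ := by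
  obtain ⟨m, k, hk, hm⟩ := h
  refine ⟨m, k, hk, fun z hz => ?_⟩
  filter_upwards [hm z hz, he z hz] with t h1 h2
  rw [h2, h1]

theorem MeromorphicFamily.add {H₁ H₂ : ℂ → (Fin n → ℂ) → ℂ} (h₁ : MeromorphicFamily α H₁)
    (h₂ : MeromorphicFamily α H₂) : MeromorphicFamily α fun t z => H₁ t z + H₂ t z := by
  obtain ⟨m₁, k₁, hk₁, hm₁⟩ := h₁
  obtain ⟨m₂, k₂, hk₂, hm₂⟩ := h₂
  -- The exponent m₁ + m₂ + 2 is the sum of the two exponents m₁ + 1 and m₂ + 1.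
  refine ⟨m₁ + m₂ + 1, _,
    ((AnalyticFamily.of_analyticAt (u := fun t => (t - α) ^ (m₂ + 1)) (by fun_prop)).mul hk₁).add
    ((AnalyticFamily.of_analyticAt (u := fun t => (t - α) ^ (m₁ + 1)) (by fun_prop)).mul hk₂),
    fun z hz => ?_⟩
  filter_upwards [hm₁ z hz, hm₂ z hz] with t h1 h2
  rw [← h1, ← h2]
  ring

theorem MeromorphicFamily.mul {H₁ H₂ : ℂ → (Fin n → ℂ) → ℂ} (h₁ : MeromorphicFamily α H₁)
    (h₂ : MeromorphicFamily α H₂) : MeromorphicFamily α fun t z => H₁ t z * H₂ t z := by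
  obtain ⟨m₁, k₁, hk₁, hm₁⟩ := h₁
  obtain ⟨m₂, k₂, hk₂, hm₂⟩ := h₂
  refine ⟨m₁ + m₂ + 1, _, hk₁.mul hk₂, fun z hz => ?_⟩
  filter_upwards [hm₁ z hz, hm₂ z hz] with t h1 h2
  rw [← h1, ← h2]
  ring

theorem MeromorphicFamily.sum {ι : Type*} (s : Finset ι) {H : ι → ℂ → (Fin n → ℂ) → ℂ}
    (h : ∀ i ∈ s, MeromorphicFamily α (H i)) :
    MeromorphicFamily α fun t z => ∑ i ∈ s, H i t z := by
  classical
  induction s using Finset.induction_on with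
  | empty => exact .of_meromorphicAt (u := fun _ => 0) analyticAt_const.meromorphicAt
  | insert i s hi ih =>
    simp only [Finset.sum_insert hi]
    exact (h i (by simp)).add (ih fun j hj => h j (by simp [hj]))

theorem MeromorphicFamily.meromorphicAt {H : ℂ → (Fin n → ℂ) → ℂ} (h : MeromorphicFamily α H)
    {z : Fin n → ℂ} (hz : z ∈ regularSet n) : MeromorphicAt (fun t => H t z) α := by
  obtain ⟨m, k, hk, hm⟩ := h
  have h1 : MeromorphicAt (fun t => ((t - α) ^ (m + 1))⁻¹ * k t z) α :=
    (MeromorphicAt.inv (f := fun t => (t - α) ^ (m + 1))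
      (AnalyticAt.meromorphicAt (by fun_prop))).mul (hk.1 z hz).meromorphicAt
  refine h1.congr ?_
  filter_upwards [hm z hz, self_mem_nhdsWithin] with t h2 ht
  have : t - α ≠ 0 := sub_ne_zero.mpr ht
  rw [← h2]
  field_simp

/-- The pole order is bounded uniformly in z, so the residue is the Taylor coefficient of one fixed
order m. -/
theorem MeromorphicFamily.residue_mem {H : ℂ → (Fin n → ℂ) → ℂ} (h : MeromorphicFamily α H) :
    (fun z => residue (fun t => H t z) α) ∈ poleAlgebra n := by
  obtain ⟨m, k, hk, hm⟩ := h
  refine poleAlgebra_congr ((poleAlgebra n).mul_mem (hk.2 m)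
    (const_mem_poleAlgebra n (m.factorial : ℂ)⁻¹)) fun z hz => ?_
  rw [residue_eq_iteratedDeriv (hk.1 z hz) (hm z hz)]
  exact div_eq_mul_inv _ _

/-- A family of functions of `t` that may be substituted for a variable of an element of
`poleAlgebra`. -/
def IsSubstitutable (α : ℂ) {n : ℕ} (w : ℂ → (Fin n → ℂ) → ℂ) : Prop :=
  (∀ β : ℂ, β = 1 ∨ β = -1 → MeromorphicFamily α fun t z => (w t z - β)⁻¹) ∧
    ∀ z ∈ regularSet n, ∀ᶠ t in 𝓝[≠] α, w t z ≠ 1 ∧ w t z ≠ -1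

/-- It suffices to check generators. One that vanishes on regular tuples becomes zero on a punctured
neighbourhood of α, because the substituted values eventually avoid ±1. -/
theorem IsSubstitutable.comp_mem {m : ℕ} {w : Fin m → ℂ → (Fin n → ℂ) → ℂ}
    (hw : ∀ i, IsSubstitutable α (w i)) {f : (Fin m → ℂ) → ℂ} (hf : f ∈ poleAlgebra m) :
    MeromorphicFamily α fun t z => f fun i => w i t z := by
  induction hf using Algebra.adjoin_induction with
  | mem f hf =>
    rcases hf with ⟨i, β, hβ, rfl⟩ | hf
    · exact (hw i).1 β hβ
    · refine MeromorphicFamily.congr (.of_meromorphicAt (u := fun _ => 0)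
        analyticAt_const.meromorphicAt) fun z hz => ?_
      filter_upwards [eventually_all.mpr fun i => (hw i).2 z hz] with t ht
      exact hf ht
  | algebraMap r => exact .of_meromorphicAt (u := fun _ => r) analyticAt_const.meromorphicAt
  | add f g _ _ hf hg => exact hf.add hg
  | mul f g _ _ hf hg => exact hf.mul hg

theorem IsSubstitutable.coordinate (j : Fin n) : IsSubstitutable α fun _ z => z j :=
  ⟨fun _ hβ => (AnalyticFamily.of_mem (inv_sub_mem_poleAlgebra j hβ)).meromorphicFamily,
    fun _ hz => Eventually.of_forall fun _ => hz j⟩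

theorem eventually_ne_branch (α : ℂ) : ∀ᶠ t in 𝓝[≠] α, t ≠ 0 ∧ t ≠ 1 ∧ t ≠ -1 := by
  have h : ∀ c : ℂ, ∀ᶠ t in 𝓝[≠] α, t ≠ c := by
    intro c
    by_cases hc : α = c
    · subst hc
      exact self_mem_nhdsWithin
    · exact (eventually_ne_nhds hc).filter_mono nhdsWithin_le_nhds
  filter_upwards [h 0, h 1, h (-1)] with t h0 h1 h2 using ⟨h0, h1, h2⟩

theorem IsSubstitutable.id : IsSubstitutable α fun t (_ : Fin n → ℂ) => t :=
  ⟨fun β _ => .of_meromorphicAt (MeromorphicAt.inv (f := fun t => t - β)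
    (AnalyticAt.meromorphicAt (by fun_prop))), fun _ _ => (eventually_ne_branch α).mono
    fun _ ht => ht.2⟩

theorem analyticAt_hat (hα : α = 1 ∨ α = -1) : AnalyticAt ℂ hat α :=
  analyticAt_inv (by rcases hα with rfl | rfl <;> norm_num)

theorem hat_eq_self (hα : α = 1 ∨ α = -1) : hat α = α := by
  rcases hα with rfl | rfl <;> norm_num [hat]

theorem IsSubstitutable.hat (hα : α = 1 ∨ α = -1) :
    IsSubstitutable α fun t (_ : Fin n → ℂ) => hat t := by
  refine ⟨fun β _ => .of_meromorphicAt (MeromorphicAt.inv (f := fun t => EynardOrantin.hat t - β)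
    ((analyticAt_hat hα).sub analyticAt_const).meromorphicAt), fun _ _ => ?_⟩
  filter_upwards [eventually_ne_branch α] with t ht
  refine ⟨fun h => ht.2.1 ?_, fun h => ht.2.2 ?_⟩
  · rw [← inv_inv t, show t⁻¹ = 1 from h, inv_one]
  · rw [← inv_inv t, show t⁻¹ = -1 from h, inv_neg, inv_one]

/-! ### The invariants are rational with poles on the branch points only -/

/-- The expression in brackets in the recursion. -/
def recursionTerm (y : ℂ → ℂ) (g n : ℕ) (t : ℂ) (z : Fin n → ℂ) : ℂ :=
  (if 1 ≤ g then omega y (g - 1) (n + 2) (Fin.cons t (Fin.cons (hat t) z)) else 0) +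
    ∑ g₁ : Fin (g + 1), ∑ I : Finset (Fin n),
      if ((g₁ : ℕ) = 0 ∧ I.card = 0) ∨ (g - (g₁ : ℕ) = 0 ∧ Iᶜ.card = 0) then 0
      else omega y (g₁ : ℕ) (I.card + 1) (Fin.cons t (subTuple z I)) *
        omega y (g - (g₁ : ℕ)) (Iᶜ.card + 1) (Fin.cons (hat t) (subTuple z Iᶜ))

theorem omega_succ (y : ℂ → ℂ) {g n : ℕ} (h : 2 ≤ 2 * g + n) (z : Fin (n + 1) → ℂ) :
    omega y g (n + 1) z = ∑ α ∈ ({1, -1} : Finset ℂ), residue (fun t =>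
      kernel y (z 0) t * recursionTerm y g n t (Fin.tail z) * deriv hat t) α := by
  refine (omega.eq_4 y g n z (fun _ _ _ _ => by omega) (fun _ _ _ _ => by omega)).trans ?_
  simp only [recursionTerm, dite_eq_ite]

/-- A factor of a product term in the recursion. Stable factors lie in the pole algebra by
hypothesis. The remaining one, ω^0_2(u, z_j), has its pole on the diagonal, but near t = α it is
regular because u α = α ≠ z_j. -/
theorem omega_cons_family (y : ℂ → ℂ) (hα : α = 1 ∨ α = -1) {u : ℂ → ℂ} (hu : AnalyticAt ℂ u α)
    (hu' : u α = α) (hs : IsSubstitutable α fun t (_ : Fin n → ℂ) => u t) {g k : ℕ}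
    (e : Fin k → Fin n) (h0 : ¬(g = 0 ∧ k = 0))
    (h : 3 ≤ 2 * g + (k + 1) → omega y g (k + 1) ∈ poleAlgebra (k + 1)) :
    MeromorphicFamily α fun t (z : Fin n → ℂ) =>
      omega y g (k + 1) (Fin.cons (u t) fun i => z (e i)) := by
  by_cases h3 : 3 ≤ 2 * g + (k + 1)
  · have key : MeromorphicFamily α fun t (z : Fin n → ℂ) => omega y g (k + 1) fun i =>
        (Fin.cons (fun t _ => u t) (fun i _ z => z (e i)) :
          Fin (k + 1) → ℂ → (Fin n → ℂ) → ℂ) i t z := by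
      refine IsSubstitutable.comp_mem (fun i => ?_) (h h3)
      refine Fin.cases ?_ (fun i => ?_) i
      · simpa using hs
      · simpa using IsSubstitutable.coordinate (e i)
    refine key.congr fun z _ => Eventually.of_forall fun t => ?_
    congr 1
    funext i
    refine Fin.cases ?_ (fun i => ?_) i <;> simp
  · obtain rfl : g = 0 := by omega
    obtain rfl : k = 1 := by omega
    have h1 := (AnalyticFamily.inv_sub hα (e 0) hu hu').meromorphicFamily
    refine (h1.mul h1).congr fun z _ => Eventually.of_forall fun t => ?_
    rw [omega.eq_3, bergmann, ← neg_sub, neg_sq]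
    simp [sq]

theorem recursionTerm_family (y : ℂ → ℂ) (hα : α = 1 ∨ α = -1) {g n : ℕ} (h2 : 2 ≤ 2 * g + n)
    (ih : ∀ g' k, 3 ≤ 2 * g' + (k + 1) → 2 * g' + k < 2 * g + n →
      omega y g' (k + 1) ∈ poleAlgebra (k + 1)) :
    MeromorphicFamily α fun t (z : Fin (n + 1) → ℂ) => recursionTerm y g n t (Fin.tail z) := by
  have hzero : MeromorphicFamily α fun (_ : ℂ) (_ : Fin (n + 1) → ℂ) => 0 :=
    .of_meromorphicAt (u := fun _ => 0) analyticAt_const.meromorphicAt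
  unfold recursionTerm
  refine MeromorphicFamily.add ?_ (.sum _ fun g₁ _ => .sum _ fun I _ => ?_)
  · split_ifs with hg
    · by_cases h3 : 3 ≤ 2 * (g - 1) + (n + 2)
      · have key : MeromorphicFamily α fun t (z : Fin (n + 1) → ℂ) => omega y (g - 1) (n + 2)
            fun i => (Fin.cons (fun t _ => t) (Fin.cons (fun t _ => hat t)
              (fun i _ z => z i.succ)) : Fin (n + 2) → ℂ → (Fin (n + 1) → ℂ) → ℂ) i t z := by
          refine IsSubstitutable.comp_mem (fun i => ?_) (ih (g - 1) (n + 1) (by omega) (by omega))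
          refine Fin.cases ?_ (fun i => Fin.cases ?_ (fun i => ?_) i) i
          · simpa using IsSubstitutable.id
          · simpa using IsSubstitutable.hat hα
          · simpa using IsSubstitutable.coordinate i.succ
        refine key.congr fun z _ => Eventually.of_forall fun t => ?_
        congr 1
        funext i
        refine Fin.cases ?_ (fun i => Fin.cases ?_ (fun i => ?_) i) i <;> simp [Fin.tail]
      -- The only unstable case is ω^0_2(t, t̂), which involves no parameters.
      · obtain rfl : g = 1 := by omega
        obtain rfl : n = 0 := by omega
        have h1 : MeromorphicAt (fun t => bergmann t (hat t)) α := by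
          refine MeromorphicAt.div analyticAt_const.meromorphicAt ?_
          exact ((analyticAt_id.sub (analyticAt_hat hα)).pow 2).meromorphicAt
        refine (MeromorphicFamily.of_meromorphicAt h1).congr fun z _ =>
          Eventually.of_forall fun t => ?_
        rw [Nat.sub_self, omega.eq_3]
        simp
    · exact hzero
  · have hI := Finset.card_add_card_compl I
    have hg₁ := g₁.isLt
    simp only [Fintype.card_fin] at hI
    split_ifs with h
    · exact hzero
    · refine MeromorphicFamily.mul ?_ ?_
      · exact omega_cons_family y hα (u := fun t => t) analyticAt_id rfl IsSubstitutable.id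
          (fun i => (I.orderEmbOfFin rfl i).succ) (fun h' => h (Or.inl h'))
          fun h3 => ih _ _ h3 (by omega)
      · exact omega_cons_family y hα (u := hat) (analyticAt_hat hα) (hat_eq_self hα)
          (IsSubstitutable.hat hα) (fun i => (Iᶜ.orderEmbOfFin rfl i).succ)
          (fun h' => h (Or.inr h')) fun h3 => ih _ _ h3 (by omega)

/-- The factor of the integrand of the recursion that comes from the curve. -/
def curveFactor (y : ℂ → ℂ) (t : ℂ) : ℂ :=
  -(2 * (y t - y (hat t)) * dx t)⁻¹ * deriv hat t

theorem analyticAt_dx {α : ℂ} (hα : α = 1 ∨ α = -1) : AnalyticAt ℂ dx α :=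
  (analyticAt_id.add (analyticAt_hat hα) : AnalyticAt ℂ xFun α).deriv

theorem meromorphicAt_curveFactor (hα : α = 1 ∨ α = -1) {y : ℂ → ℂ} (hy : AnalyticAt ℂ y α) :
    MeromorphicAt (curveFactor y) α := by
  have h1 : AnalyticAt ℂ (fun t => y (hat t)) α :=
    AnalyticAt.comp (f := hat) (by rwa [hat_eq_self hα]) (analyticAt_hat hα)
  exact (MeromorphicAt.inv (f := fun t => 2 * (y t - y (hat t)) * dx t)
    ((analyticAt_const.mul (hy.sub h1)).mul (analyticAt_dx hα)).meromorphicAt).neg.mul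
    (analyticAt_hat hα).deriv.meromorphicAt

/-- This separates the dependence on z₀, which sits entirely in the integrated Bergmann kernel. -/
theorem kernel_mul (y : ℂ → ℂ) (z t c : ℂ) :
    kernel y z t * c * deriv hat t = bergmannInt z t * (curveFactor y t * c) := by
  rw [kernel, curveFactor, div_eq_mul_inv]
  ring

theorem omega_mem_poleAlgebra {y : ℂ → ℂ} (h₁ : AnalyticAt ℂ y 1) (h₂ : AnalyticAt ℂ y (-1))
    (g n : ℕ) (h : 2 ≤ 2 * g + n) : omega y g (n + 1) ∈ poleAlgebra (n + 1) := by
  induction hN : 2 * g + n using Nat.strong_induction_on generalizing g n with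
  | _ N ih =>
    subst hN
    refine poleAlgebra_congr (sum_mem_poleAlgebra ({1, -1} : Finset ℂ) fun α hα => ?_)
      fun z _ => omega_succ y h z
    have hα' : α = 1 ∨ α = -1 := by simpa using hα
    have hy : AnalyticAt ℂ y α := by rcases hα' with rfl | rfl <;> assumption
    refine MeromorphicFamily.residue_mem ?_
    simp only [kernel_mul, bergmannInt, one_div, sub_eq_add_neg _ (_ - hat _)⁻¹,
      ← neg_one_mul (_ - hat _)⁻¹]
    refine MeromorphicFamily.mul ?_ (MeromorphicFamily.mul
      (.of_meromorphicAt (meromorphicAt_curveFactor hα' hy))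
      (recursionTerm_family y hα' h fun g' k h3 hlt => ih _ hlt g' k (by omega) rfl))
    exact (AnalyticFamily.add (AnalyticFamily.inv_sub hα' 0 analyticAt_id rfl)
      ((AnalyticFamily.of_analyticAt (u := fun _ => -1) analyticAt_const).mul
        (AnalyticFamily.inv_sub hα' 0 (analyticAt_hat hα') (hat_eq_self hα')))).meromorphicFamily

/-- With no further variables the bracket depends on t alone, so it joins the curve factor in G. The
tuple `![0]` is a dummy regular tuple whose tail is empty. -/
theorem exists_omega_one_eq {y : ℂ → ℂ} (h₁ : AnalyticAt ℂ y 1) (h₂ : AnalyticAt ℂ y (-1))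
    {g : ℕ} (hg : 1 ≤ g) : ∃ G : ℂ → ℂ, (∀ α : ℂ, α = 1 ∨ α = -1 → MeromorphicAt G α) ∧
      ∀ z : ℂ, omega y g 1 ![z] = ∑ α ∈ ({1, -1} : Finset ℂ),
        residue (fun t => bergmannInt z t * G t) α := by
  refine ⟨fun t => curveFactor y t * recursionTerm y g 0 t (Fin.tail ![0]), fun α hα => ?_,
    fun z => ?_⟩
  · have hy : AnalyticAt ℂ y α := by rcases hα with rfl | rfl <;> assumption
    refine (meromorphicAt_curveFactor hα hy).mul ?_
    refine (recursionTerm_family y hα (n := 0) (by omega) fun g' k h3 _ =>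
      omega_mem_poleAlgebra h₁ h₂ g' k (by omega)).meromorphicAt (z := ![0]) fun i => ?_
    fin_cases i
    simp
  · rw [omega_succ y (by omega)]
    refine Finset.sum_congr rfl fun α _ => ?_
    congr 1
    funext t
    rw [kernel_mul, Subsingleton.elim (Fin.tail ![z]) (Fin.tail ![0])]
    simp

/-! ### The polar part of `ω^g_1` -/

/-- The involution fixes α, so (t̂ - α)^k is divisible by (t - α)^k; remainders of Taylor expansions
stay small after t ↦ t̂. -/
theorem hat_sub_eq {α : ℂ} (hα : α = 1 ∨ α = -1) {t : ℂ} (ht : t ≠ 0) :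
    hat t - α = (t - α) * (-α * hat t) := by
  have h2 : α * α = 1 := by rcases hα with rfl | rfl <;> norm_num
  simp only [hat]
  field_simp
  linear_combination -h2

/-- Beyond the pole order of G the Taylor remainder of F(t) - F(t̂) cancels the pole and leaves no
residue; the constant term of F drops out of the difference. The bound m depends on G only, so a
single K serves every F and both branch points. -/
theorem exists_residue_sub_comp_hat_eq {α : ℂ} (hα : α = 1 ∨ α = -1) {G : ℂ → ℂ}
    (hG : MeromorphicAt G α) : ∃ m : ℕ, ∀ K, m ≤ K → ∀ (F ρ : ℂ → ℂ) (a : ℕ → ℂ),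
      AnalyticAt ℂ ρ α →
      (∀ᶠ t in 𝓝 α, F t = (∑ j ∈ Finset.range (K + 1), a j * (t - α) ^ j)
        + (t - α) ^ (K + 1) * ρ t) →
      residue (fun t => (F t - F (hat t)) * G t) α = ∑ i ∈ Finset.range K,
        a (i + 1) * residue (fun t => ((t - α) ^ (i + 1) - (hat t - α) ^ (i + 1)) * G t) α := by
  obtain ⟨m, h, hh, hm⟩ := hG.exists_pow_succ_mul
  have hhat := analyticAt_hat hα
  refine ⟨m, fun K hK F ρ a hρ hF => ?_⟩
  obtain ⟨d, rfl⟩ := Nat.exists_eq_add_of_le hK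
  have hρ' : AnalyticAt ℂ (fun t => ρ (hat t)) α :=
    AnalyticAt.comp (f := hat) (by rwa [hat_eq_self hα]) hhat
  have hrest : AnalyticAt ℂ (fun t => (t - α) ^ d * h t *
      (ρ t - (-α * hat t) ^ (m + d + 1) * ρ (hat t))) α :=
    (AnalyticAt.mul (by fun_prop) hh).mul
      (hρ.sub (((analyticAt_const.mul hhat).pow (m + d + 1)).mul hρ'))
  have hterm : ∀ j, MeromorphicAt (fun t => ((t - α) ^ j - (hat t - α) ^ j) * G t) α := by
    intro j
    refine MeromorphicAt.mul (f := fun t => (t - α) ^ j - (hat t - α) ^ j) ?_ hG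
    exact AnalyticAt.meromorphicAt (by fun_prop)
  have hterm' : ∀ j, MeromorphicAt
      (fun t => a j * (((t - α) ^ j - (hat t - α) ^ j) * G t)) α :=
    fun j => (MeromorphicAt.const (a j) α).mul (hterm j)
  have hF' : ∀ᶠ t in 𝓝 α, F (hat t) = (∑ j ∈ Finset.range (m + d + 1), a j * (hat t - α) ^ j)
        + (hat t - α) ^ (m + d + 1) * ρ (hat t) := by
    have : Tendsto hat (𝓝 α) (𝓝 α) := by
      simpa only [hat_eq_self hα] using hhat.continuousAt.tendsto
    exact this.eventually hF
  have key : (fun t => (F t - F (hat t)) * G t) =ᶠ[𝓝[≠] α] fun t =>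
      (∑ j ∈ Finset.range (m + d + 1), a j * (((t - α) ^ j - (hat t - α) ^ j) * G t)) +
        (t - α) ^ d * h t * (ρ t - (-α * hat t) ^ (m + d + 1) * ρ (hat t)) := by
    filter_upwards [hF.filter_mono nhdsWithin_le_nhds, hF'.filter_mono nhdsWithin_le_nhds,
      eventually_ne_branch α] with t h1 h2 h3
    have h4 : (∑ j ∈ Finset.range (m + d + 1), a j * (((t - α) ^ j - (hat t - α) ^ j) * G t))
        = ((∑ j ∈ Finset.range (m + d + 1), a j * (t - α) ^ j)
          - ∑ j ∈ Finset.range (m + d + 1), a j * (hat t - α) ^ j) * G t := by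
      rw [← Finset.sum_sub_distrib, Finset.sum_mul]
      exact Finset.sum_congr rfl fun j _ => by ring
    have h5 : (hat t - α) ^ (m + d + 1) = (t - α) ^ (m + d + 1) * (-α * hat t) ^ (m + d + 1) := by
      rw [← mul_pow, ← hat_sub_eq hα h3.1]
    rw [h1, h2, h4, h5, ← hm t]
    ring
  rw [residue_congr key, residue_add (MeromorphicAt.fun_sum fun j _ => hterm' j)
    hrest.meromorphicAt, residue_of_analyticAt hrest, add_zero,
    residue_sum _ fun j _ => hterm' j, Finset.sum_range_succ']
  simp only [residue_const_mul _ (hterm _)]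
  have h0 : residue (fun t => ((t - α) ^ 0 - (hat t - α) ^ 0) * G t) α = 0 := by
    simpa using residue_of_analyticAt (f := fun _ => 0) (a := α) analyticAt_const
  rw [h0, mul_zero, add_zero]

theorem one_div_sub_eq_sum {z α t : ℂ} (h1 : z ≠ α) (h2 : z ≠ t) (n : ℕ) :
    1 / (z - t) = (∑ j ∈ Finset.range n, ((z - α) ^ (j + 1))⁻¹ * (t - α) ^ j)
      + (t - α) ^ n * (((z - α) ^ n)⁻¹ * (z - t)⁻¹) := by
  have h1' := sub_ne_zero.mpr h1
  have h2' := sub_ne_zero.mpr h2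
  induction n with
  | zero => simp
  | succ n ih =>
    rw [ih, Finset.sum_range_succ, add_assoc]
    congr 1
    field_simp
    ring

/-- The functional `f ↦ ∑_α Res_{z=α} F(z) ω(z)`, where `dF = f`, for the form
`ω(z) = ∑_α ∑_i d α i / (z - α)^(i+2)`. -/
def polarFunctional (K : ℕ) (d : ℂ → ℕ → ℂ) (f : ℂ → ℂ) : ℂ :=
  ∑ α ∈ ({1, -1} : Finset ℂ), ∑ i ∈ Finset.range K,
    d α i * (iteratedDeriv i f α / (i + 1).factorial)

/-- The coefficients d are the residues of ((t-α)^(i+1) - (t̂-α)^(i+1)) G(t). The same numbers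
appear whichever F is inserted, which ties the principal parts of ω^g_1 to its antisymmetry under
the involution. -/
theorem exists_polar_form {y : ℂ → ℂ} (h₁ : AnalyticAt ℂ y 1) (h₂ : AnalyticAt ℂ y (-1))
    {g : ℕ} (hg : 1 ≤ g) : ∃ (K : ℕ) (d : ℂ → ℕ → ℂ),
      (∀ z : ℂ, z ≠ 1 → z ≠ -1 → omega y g 1 ![z] =
        ∑ α ∈ ({1, -1} : Finset ℂ), ∑ i ∈ Finset.range K, d α i * ((z - α) ^ (i + 2))⁻¹) ∧
      ∀ F : ℂ → ℂ, AnalyticAt ℂ F 1 → AnalyticAt ℂ F (-1) → (∀ t, F (hat t) = F t) →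
        polarFunctional K d (deriv F) = 0 := by
  obtain ⟨G, hG, hω⟩ := exists_omega_one_eq h₁ h₂ hg
  obtain ⟨m₁, hm₁⟩ := exists_residue_sub_comp_hat_eq (Or.inl rfl) (hG 1 (Or.inl rfl))
  obtain ⟨m₂, hm₂⟩ := exists_residue_sub_comp_hat_eq (Or.inr rfl) (hG (-1) (Or.inr rfl))
  have key : ∀ α : ℂ, α = 1 ∨ α = -1 → ∀ (F ρ : ℂ → ℂ) (a : ℕ → ℂ),
      AnalyticAt ℂ ρ α →
      (∀ᶠ t in 𝓝 α, F t = (∑ j ∈ Finset.range (m₁ + m₂ + 1), a j * (t - α) ^ j)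
        + (t - α) ^ (m₁ + m₂ + 1) * ρ t) →
      residue (fun t => (F t - F (hat t)) * G t) α = ∑ i ∈ Finset.range (m₁ + m₂),
        a (i + 1) * residue (fun t => ((t - α) ^ (i + 1) - (hat t - α) ^ (i + 1)) * G t) α := by
    rintro α (rfl | rfl)
    · exact hm₁ _ (by omega)
    · exact hm₂ _ (by omega)
  refine ⟨m₁ + m₂,
    fun α i => residue (fun t => ((t - α) ^ (i + 1) - (hat t - α) ^ (i + 1)) * G t) α,
    fun z hz1 hz2 => ?_, fun F hF1 hF2 hF => ?_⟩
  · rw [hω z]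
    refine Finset.sum_congr rfl fun α hα => ?_
    have hα' : α = 1 ∨ α = -1 := by simpa using hα
    have hne : z ≠ α := by rcases hα' with rfl | rfl <;> assumption
    refine (key α hα' (fun t => 1 / (z - t))
      (fun t => ((z - α) ^ (m₁ + m₂ + 1))⁻¹ * (z - t)⁻¹) (fun j => ((z - α) ^ (j + 1))⁻¹)
      ?_ ?_).trans (Finset.sum_congr rfl fun i _ => mul_comm _ _)
    · exact analyticAt_const.mul
        ((analyticAt_const.sub analyticAt_id).fun_inv (sub_ne_zero.mpr hne))
    · filter_upwards [eventually_ne_nhds hne.symm] with t ht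
      exact one_div_sub_eq_sum hne ht.symm _
  · refine Finset.sum_eq_zero fun α hα => ?_
    have hα' : α = 1 ∨ α = -1 := by simpa using hα
    have hFα : AnalyticAt ℂ F α := by rcases hα' with rfl | rfl <;> assumption
    obtain ⟨ρ, hρ, hT⟩ := exists_eq_taylor_add hFα (m₁ + m₂ + 1)
    have h := key α hα' F ρ _ hρ (Eventually.of_forall hT)
    -- For invariant F the integrand on the left vanishes identically.
    simp only [hF, sub_self, zero_mul] at h
    rw [residue_of_analyticAt analyticAt_const] at h
    rw [h]
    refine Finset.sum_congr rfl fun i _ => ?_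
    rw [iteratedDeriv_succ', mul_comm]

/-! ### The functional `polarFunctional` -/

section polarFunctional

variable {K : ℕ} {d : ℂ → ℕ → ℂ}

theorem polarFunctional_congr {f g : ℂ → ℂ}
    (h : ∀ α : ℂ, α = 1 ∨ α = -1 → ∀ i < K, iteratedDeriv i f α = iteratedDeriv i g α) :
    polarFunctional K d f = polarFunctional K d g := by
  refine Finset.sum_congr rfl fun α hα => Finset.sum_congr rfl fun i hi => ?_
  rw [h α (by simpa using hα) i (Finset.mem_range.mp hi)]

theorem polarFunctional_congr_of_eventuallyEq {f g : ℂ → ℂ}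
    (h : ∀ α : ℂ, α = 1 ∨ α = -1 → f =ᶠ[𝓝 α] g) :
    polarFunctional K d f = polarFunctional K d g :=
  polarFunctional_congr fun α hα i _ => (h α hα).iteratedDeriv_eq i

theorem polarFunctional_add {f g : ℂ → ℂ} (hf : ∀ α : ℂ, α = 1 ∨ α = -1 → AnalyticAt ℂ f α)
    (hg : ∀ α : ℂ, α = 1 ∨ α = -1 → AnalyticAt ℂ g α) :
    polarFunctional K d (fun s => f s + g s) = polarFunctional K d f + polarFunctional K d g := by
  unfold polarFunctional
  rw [← Finset.sum_add_distrib]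
  refine Finset.sum_congr rfl fun α hα => ?_
  have hα' : α = 1 ∨ α = -1 := by simpa using hα
  rw [← Finset.sum_add_distrib]
  refine Finset.sum_congr rfl fun i hi => ?_
  rw [iteratedDeriv_fun_add (hf α hα').contDiffAt (hg α hα').contDiffAt]
  ring

theorem polarFunctional_const_mul (c : ℂ) (f : ℂ → ℂ) :
    polarFunctional K d (fun s => c * f s) = c * polarFunctional K d f := by
  unfold polarFunctional
  simp only [Finset.mul_sum, iteratedDeriv_const_mul_field]
  refine Finset.sum_congr rfl fun α _ => Finset.sum_congr rfl fun i _ => by ring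

/-- At α only the principal part at α contributes. All its poles have order at least 2, so only
derivatives of Φ enter, that is, Taylor coefficients of y dx. -/
theorem sum_residue_mul_omega {y Φ : ℂ → ℂ} {g : ℕ}
    (hω : ∀ z : ℂ, z ≠ 1 → z ≠ -1 → omega y g 1 ![z] =
      ∑ α ∈ ({1, -1} : Finset ℂ), ∑ i ∈ Finset.range K, d α i * ((z - α) ^ (i + 2))⁻¹)
    (hΦ : IsLocalPrimitive y Φ) :
    ∑ α ∈ ({1, -1} : Finset ℂ), residue (fun z => Φ z * omega y g 1 ![z]) α
      = polarFunctional K d fun z => y z * dx z := by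
  refine Finset.sum_congr rfl fun α hα => ?_
  have hΦα := hΦ α hα
  have hA : AnalyticAt ℂ Φ α := Complex.analyticAt_iff_eventually_differentiableAt.mpr
    (hΦα.mono fun z hz => hz.differentiableAt)
  have hmer : ∀ β i, MeromorphicAt (fun z => Φ z * ((z - β) ^ (i + 2))⁻¹) α := fun β i =>
    hA.meromorphicAt.mul (MeromorphicAt.inv (f := fun z => (z - β) ^ (i + 2))
      (AnalyticAt.meromorphicAt (by fun_prop)))
  have hmer' : ∀ β i, MeromorphicAt (fun z => d β i * (Φ z * ((z - β) ^ (i + 2))⁻¹)) α :=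
    fun β i => (MeromorphicAt.const _ α).mul (hmer β i)
  have h1 : (fun z => Φ z * omega y g 1 ![z]) =ᶠ[𝓝[≠] α] fun z =>
      ∑ β ∈ ({1, -1} : Finset ℂ), ∑ i ∈ Finset.range K,
        d β i * (Φ z * ((z - β) ^ (i + 2))⁻¹) := by
    filter_upwards [eventually_ne_branch α] with z hz
    rw [hω z hz.2.1 hz.2.2, Finset.mul_sum]
    refine Finset.sum_congr rfl fun β _ => ?_
    rw [Finset.mul_sum]
    exact Finset.sum_congr rfl fun i _ => by ring
  rw [residue_congr h1,
    residue_sum _ fun β _ => MeromorphicAt.fun_sum fun i _ => hmer' β i, Finset.sum_eq_single α]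
  · rw [residue_sum _ fun i _ => hmer' α i]
    refine Finset.sum_congr rfl fun i _ => ?_
    rw [residue_const_mul _ (hmer α i), residue_mul_inv_pow hA, iteratedDeriv_succ']
    have h2 : deriv Φ =ᶠ[𝓝 α] fun z => y z * dx z := hΦα.mono fun z hz => hz.deriv
    rw [h2.iteratedDeriv_eq]
  · intro β _ hβ
    refine residue_of_analyticAt (Finset.analyticAt_fun_sum _ fun i _ => ?_)
    refine analyticAt_const.mul (hA.mul ((AnalyticAt.pow (analyticAt_id.sub analyticAt_const)
      (i + 2)).fun_inv ?_))
    exact pow_ne_zero _ (sub_ne_zero.mpr hβ.symm)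
  · exact fun h => absurd hα h

end polarFunctional

/-! ### Quasi-polynomials -/

theorem IsQuasiPolynomial.const_mul {f : ℤ → ℂ} (c : ℂ) (hf : IsQuasiPolynomial f) :
    IsQuasiPolynomial fun n => c * f n := by
  obtain ⟨p, q, h⟩ := hf
  refine ⟨C c * p, C c * q, fun n => ?_⟩
  simp only [h, eval_mul, eval_C]
  split_ifs <;> rfl

theorem IsQuasiPolynomial.add {f g : ℤ → ℂ} (hf : IsQuasiPolynomial f)
    (hg : IsQuasiPolynomial g) : IsQuasiPolynomial fun n => f n + g n := by
  obtain ⟨p, q, h⟩ := hf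
  obtain ⟨p', q', h'⟩ := hg
  refine ⟨p + p', q + q', fun n => ?_⟩
  simp only [h, h', eval_add]
  split_ifs <;> rfl

theorem IsQuasiPolynomial.mul {f g : ℤ → ℂ} (hf : IsQuasiPolynomial f)
    (hg : IsQuasiPolynomial g) : IsQuasiPolynomial fun n => f n * g n := by
  obtain ⟨p, q, h⟩ := hf
  obtain ⟨p', q', h'⟩ := hg
  refine ⟨p * p', q * q', fun n => ?_⟩
  simp only [h, h', eval_mul]
  split_ifs <;> rfl

theorem isQuasiPolynomial_eval (p : ℂ[X]) : IsQuasiPolynomial fun n => p.eval (n : ℂ) :=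
  ⟨p, p, fun n => by simp⟩

theorem IsQuasiPolynomial.sum {ι : Type*} (s : Finset ι) {f : ι → ℤ → ℂ}
    (hf : ∀ i ∈ s, IsQuasiPolynomial (f i)) : IsQuasiPolynomial fun n => ∑ i ∈ s, f i n := by
  classical
  induction s using Finset.induction_on with
  | empty => simpa using isQuasiPolynomial_eval 0
  | insert i s hi ih =>
    simp only [Finset.sum_insert hi]
    exact (hf i (by simp)).add (ih fun j hj => hf j (by simp [hj]))

/-- The dependence on parity comes from the powers of the branch point -1. -/
theorem isQuasiPolynomial_zpow {α : ℂ} (hα : α = 1 ∨ α = -1) (k : ℤ) :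
    IsQuasiPolynomial fun n => α ^ (-n - 1 - k) := by
  have hα0 : α ≠ 0 := by rcases hα with rfl | rfl <;> norm_num
  refine ⟨C (α ^ (-1 - k)), C (α ^ (-1 - k) * α), fun n => ?_⟩
  have h : α ^ (-n - 1 - k) = α ^ (-n) * α ^ (-1 - k) := by
    rw [← zpow_add₀ hα0]
    congr 1
    ring
  simp only [h, eval_C]
  rcases hα with rfl | rfl
  · simp
  · rcases Int.even_or_odd n with hn | hn
    · rw [if_pos hn, hn.neg.neg_one_zpow, one_mul]
    · rw [if_neg (Int.not_even_iff_odd.mpr hn), hn.neg.neg_one_zpow, mul_comm]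

theorem eq_of_eval_natCast_eq {p q : ℂ[X]} {s : Set ℕ} (hs : s.Infinite)
    (h : ∀ n ∈ s, p.eval (n : ℂ) = q.eval (n : ℂ)) : p = q := by
  refine Polynomial.eq_of_infinite_eval_eq p q
    ((hs.image (Nat.cast_injective (R := ℂ)).injOn).mono ?_)
  rintro _ ⟨n, hn, rfl⟩
  exact h n hn

/-- Each of the two polynomials is determined by infinitely many positive integers of its parity. -/
theorem IsQuasiPolynomial.ext {f g : ℤ → ℂ} (hf : IsQuasiPolynomial f)
    (hg : IsQuasiPolynomial g) (h : ∀ n : ℕ, f ((n : ℤ) + 1) = g ((n : ℤ) + 1)) : f = g := by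
  obtain ⟨p, q, hp⟩ := hf
  obtain ⟨p', q', hp'⟩ := hg
  have h' : ∀ n : ℕ, 0 < n → f n = g n := by
    intro n hn
    obtain ⟨k, rfl⟩ := Nat.exists_eq_succ_of_ne_zero hn.ne'
    simpa using h k
  have e1 : p = p' := by
    refine eq_of_eval_natCast_eq (s := {n | 0 < n ∧ Even n})
      (Set.infinite_of_forall_exists_gt fun a => ⟨2 * (a + 1), ⟨by omega, by simp⟩, by omega⟩) ?_
    rintro n ⟨hn, hn'⟩
    have := h' n hn
    rw [hp, hp', if_pos (by exact_mod_cast hn'), if_pos (by exact_mod_cast hn')] at this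
    simpa using this
  have e2 : q = q' := by
    refine eq_of_eval_natCast_eq (s := {n | 0 < n ∧ ¬Even n})
      (Set.infinite_of_forall_exists_gt fun a => ⟨2 * a + 1, ⟨by omega, by simp⟩, by omega⟩) ?_
    rintro n ⟨hn, hn'⟩
    have := h' n hn
    rw [hp, hp', if_neg (by exact_mod_cast hn'), if_neg (by exact_mod_cast hn')] at this
    simpa using this
  funext n
  rw [hp, hp', e1, e2]

theorem eq_of_eventually_hasSum {f : ℂ → ℂ} {a b : ℕ → ℂ}
    (ha : ∀ᶠ z in 𝓝 (0 : ℂ), HasSum (fun n => a n * z ^ n) (f z))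
    (hb : ∀ᶠ z in 𝓝 (0 : ℂ), HasSum (fun n => b n * z ^ n) (f z)) : a = b := by
  have key : ∀ c : ℕ → ℂ, (∀ᶠ z in 𝓝 (0 : ℂ), HasSum (fun n => c n * z ^ n) (f z)) →
      HasFPowerSeriesAt f (FormalMultilinearSeries.ofScalars ℂ c) 0 := by
    intro c hc
    rw [hasFPowerSeriesAt_iff]
    filter_upwards [hc] with z hz
    simpa [FormalMultilinearSeries.coeff_ofScalars, mul_comm] using hz
  have h := (key a ha).eq_formalMultilinearSeries (key b hb)
  funext n
  simpa [FormalMultilinearSeries.coeff_ofScalars] using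
    congrArg (fun p : FormalMultilinearSeries ℂ ℂ ℂ => p.coeff n) h

theorem IsN.unique {y : ℂ → ℂ} {g : ℕ} {N N' : ℤ → ℂ} (h : IsN y g N) (h' : IsN y g N') :
    N = N' := by
  refine h.quasi.ext h'.quasi fun n => ?_
  have := congrFun (eq_of_eventually_hasSum h.expansion h'.expansion) n
  exact mul_left_cancel₀ (Nat.cast_add_one_ne_zero n) this

/-! ### The quasi-polynomial of a polar part -/

/-- The quasi-polynomial `N` with `∑_α ∑_i d α i / (z - α)^(i+2) = d/dz ∑_{b>0} N(b) z^b`. -/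
def polarQuasiPolynomial (K : ℕ) (d : ℂ → ℕ → ℂ) (b : ℤ) : ℂ :=
  polarFunctional K d fun s => s ^ (-b - 1)

theorem analyticAt_zpow {α : ℂ} (hα : α = 1 ∨ α = -1) (n : ℤ) :
    AnalyticAt ℂ (fun s : ℂ => s ^ n) α :=
  analyticAt_id.fun_zpow (by rcases hα with rfl | rfl <;> norm_num)

theorem analyticAt_const_mul_zpow {α : ℂ} (hα : α = 1 ∨ α = -1) (c : ℂ) (n : ℤ) :
    AnalyticAt ℂ (fun s : ℂ => c * s ^ n) α :=
  analyticAt_const.mul (analyticAt_zpow hα n)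

/-- The i-th derivative of s^(-b-1) at α is a polynomial in b of degree i times a power of α = ±1.
-/
theorem isQuasiPolynomial_polarQuasiPolynomial (K : ℕ) (d : ℂ → ℕ → ℂ) :
    IsQuasiPolynomial (polarQuasiPolynomial K d) := by
  unfold polarQuasiPolynomial polarFunctional
  refine IsQuasiPolynomial.sum _ fun α hα => IsQuasiPolynomial.sum _ fun i _ => ?_
  simp only [iteratedDeriv_eq_iterate, iter_deriv_zpow, div_eq_mul_inv]
  refine ((IsQuasiPolynomial.mul ?_ (isQuasiPolynomial_zpow (by simpa using hα) i)).mul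
    (by simpa using isQuasiPolynomial_eval (C ((((i + 1).factorial : ℕ) : ℂ)⁻¹)))).const_mul _
  have h := isQuasiPolynomial_eval (∏ k ∈ Finset.range i, (-X - 1 - C (k : ℂ)))
  simp only [eval_prod, eval_sub, eval_neg, eval_X, eval_one, eval_C] at h
  simpa using h

theorem mul_prod_eq_choose (b i : ℕ) :
    ((b : ℂ) + 1) * ∏ k ∈ Finset.range i, (-((b : ℂ) + 1) - 1 - k)
      = (-1) ^ i * (i + 1).factorial * ((b + (i + 1)).choose (i + 1) : ℂ) := by
  induction i with
  | zero => simp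
  | succ i ih =>
    rw [Finset.prod_range_succ, ← mul_assoc, ih, Nat.factorial_succ (i + 1)]
    have h : ((b + (i + 1) + 1 : ℕ) : ℂ) * ((b + (i + 1)).choose (i + 1) : ℂ)
        = ((b + (i + 1 + 1)).choose (i + 1 + 1) : ℂ) * ((i + 1 + 1 : ℕ) : ℂ) := by
      exact_mod_cast Nat.add_one_mul_choose_eq (b + (i + 1)) (i + 1)
    push_cast at h ⊢
    linear_combination (-1) ^ (i + 1) * ((i + 1).factorial : ℂ) * h

/-- The binomial series of (1 - αz)^(-(i+2)), using α⁻¹ = α. `mul_prod_eq_choose` matches its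
coefficients with the falling products from differentiating s^(-b-2). -/
theorem hasSum_polar_term {α : ℂ} (hα : α = 1 ∨ α = -1) (c : ℂ) (i : ℕ) {z : ℂ} (hz : ‖z‖ < 1) :
    HasSum (fun b : ℕ => ((b : ℂ) + 1) * (c * (iteratedDeriv i
      (fun s : ℂ => s ^ (-((b : ℤ) + 1) - 1)) α / (i + 1).factorial)) * z ^ b)
      (c * ((z - α) ^ (i + 2))⁻¹) := by
  have hα2 : α * α = 1 := by rcases hα with rfl | rfl <;> norm_num
  have hα0 : α ≠ 0 := left_ne_zero_of_mul_eq_one hα2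
  have hαinv : α⁻¹ = α := inv_eq_of_mul_eq_one_left hα2
  have hnorm : ‖α * z‖ < 1 := by rcases hα with rfl | rfl <;> simpa
  have h := (hasSum_choose_mul_geometric_of_norm_lt_one (i + 1) hnorm).mul_left
    (c * (-α) ^ i)
  have hsum : c * (-α) ^ i * (1 / (1 - α * z) ^ (i + 1 + 1)) = c * ((z - α) ^ (i + 2))⁻¹ := by
    have h1 : z - α = -α * (1 - α * z) := by linear_combination -z * hα2
    have h2 : ((-α) ^ (i + 2))⁻¹ = (-α) ^ i := by
      rw [← inv_pow, inv_neg, hαinv, pow_add]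
      linear_combination (-α) ^ i * hα2
    rw [h1, mul_pow, mul_inv, h2]
    ring
  rw [hsum] at h
  refine h.congr_fun ?_
  intro b
  rw [iteratedDeriv_eq_iterate, iter_deriv_zpow]
  have h3 : α ^ (-((b : ℤ) + 1) - 1 - i) = α ^ i * α ^ b := by
    have : -((b : ℤ) + 1) - 1 - i = -((i + b + 2 : ℕ) : ℤ) := by push_cast; ring
    rw [this, zpow_neg, zpow_natCast, ← inv_pow, hαinv]
    linear_combination α ^ (i + b) * hα2
  rw [h3]
  have h4 := mul_prod_eq_choose b i
  have h5 : ((i + 1).factorial : ℂ) ≠ 0 := Nat.cast_ne_zero.mpr (Nat.factorial_ne_zero _)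
  push_cast at h4 ⊢
  rw [neg_pow α i, mul_pow]
  field_simp
  linear_combination c * z ^ b * h4

theorem isN_polarQuasiPolynomial {y : ℂ → ℂ} {g K : ℕ} {d : ℂ → ℕ → ℂ}
    (hω : ∀ z : ℂ, z ≠ 1 → z ≠ -1 → omega y g 1 ![z] =
      ∑ α ∈ ({1, -1} : Finset ℂ), ∑ i ∈ Finset.range K, d α i * ((z - α) ^ (i + 2))⁻¹) :
    IsN y g (polarQuasiPolynomial K d) := by
  refine ⟨isQuasiPolynomial_polarQuasiPolynomial K d, ?_⟩
  filter_upwards [Metric.ball_mem_nhds (0 : ℂ) one_pos] with z hz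
  have hz' : ‖z‖ < 1 := by simpa using hz
  rw [hω z (by rintro rfl; simp at hz') (by rintro rfl; simp at hz')]
  refine (hasSum_sum fun α hα => hasSum_sum fun i _ =>
    hasSum_polar_term (α := α) (by simpa using hα) (d α i) i hz').congr_fun fun b => ?_
  simp only [polarQuasiPolynomial, polarFunctional, Finset.mul_sum, Finset.sum_mul]

/-- The function s^b + s^(-b) is invariant under s ↦ 1/s. Applying the functional to its derivative
gives b (N(-b) - N(b)) = 0. -/
theorem polarQuasiPolynomial_neg {K : ℕ} {d : ℂ → ℕ → ℂ}
    (h : ∀ F : ℂ → ℂ, AnalyticAt ℂ F 1 → AnalyticAt ℂ F (-1) → (∀ t, F (hat t) = F t) →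
      polarFunctional K d (deriv F) = 0) (b : ℤ) :
    polarQuasiPolynomial K d (-b) = polarQuasiPolynomial K d b := by
  rcases eq_or_ne b 0 with rfl | hb
  · simp
  have hb' : (b : ℂ) ≠ 0 := Int.cast_ne_zero.mpr hb
  have hA : ∀ α : ℂ, α = 1 ∨ α = -1 →
      AnalyticAt ℂ (fun s : ℂ => s ^ b + s ^ (-b)) α := fun α hα =>
    (analyticAt_zpow hα b).add (analyticAt_zpow hα (-b))
  have h0 := h _ (hA 1 (Or.inl rfl)) (hA (-1) (Or.inr rfl)) fun t => by
    simp only [hat, inv_zpow', neg_neg]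
    exact add_comm _ _
  have h1 : polarFunctional K d (deriv fun s : ℂ => s ^ b + s ^ (-b)) =
      polarFunctional K d fun s => b * s ^ (-(-b) - 1) + (-b) * s ^ (-b - 1) := by
    refine polarFunctional_congr_of_eventuallyEq fun α hα => ?_
    have hα0 : α ≠ 0 := by rcases hα with rfl | rfl <;> norm_num
    filter_upwards [eventually_ne_nhds hα0] with s hs
    rw [((hasDerivAt_zpow b s (Or.inl hs)).fun_add (hasDerivAt_zpow (-b) s (Or.inl hs))).deriv]
    push_cast
    simp
  rw [h1, polarFunctional_add (fun α hα => analyticAt_const_mul_zpow hα _ _)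
    (fun α hα => analyticAt_const_mul_zpow hα _ _), polarFunctional_const_mul,
    polarFunctional_const_mul] at h0
  refine mul_left_cancel₀ hb' ?_
  simp only [polarQuasiPolynomial]
  linear_combination h0

/-! ### The symplectic invariants -/

theorem applyShift_add (p q : ℂ[X]) (f : ℤ → ℂ) (a : ℤ) :
    applyShift (p + q) f a = applyShift p f a + applyShift q f a :=
  Polynomial.sum_add_index p q _ (fun _ => zero_mul _) fun _ _ _ => add_mul _ _ _

theorem applyShift_monomial (n : ℕ) (c : ℂ) (f : ℤ → ℂ) (a : ℤ) :
    applyShift (monomial n c) f a = c * f (a + n) :=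
  Polynomial.sum_monomial_index c _ (zero_mul _)

theorem dx_eventuallyEq {α : ℂ} (hα : α ≠ 0) : dx =ᶠ[𝓝 α] fun s => 1 - s ^ (-2 : ℤ) := by
  filter_upwards [eventually_ne_nhds hα] with s hs
  have h : HasDerivAt xFun (1 + -(s ^ 2)⁻¹) s := (hasDerivAt_id s).add (hasDerivAt_inv hs)
  rw [dx, h.deriv, ← sub_eq_add_neg, zpow_neg]
  norm_cast

/-- On s^n the functional gives N(-n-1) - N(1-n). Evenness of N turns this into N(n+1) - N(n-1),
which is minus the shift expression based at -1. -/
theorem polarFunctional_polynomial_mul_dx {K : ℕ} {d : ℂ → ℕ → ℂ}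
    (hN : ∀ b, polarQuasiPolynomial K d (-b) = polarQuasiPolynomial K d b) (p : ℂ[X]) :
    polarFunctional K d (fun s => p.eval s * dx s)
      = -applyShift ((1 - X ^ 2) * p) (polarQuasiPolynomial K d) (-1) := by
  induction p using Polynomial.induction_on' with
  | add p q hp hq =>
    have hA : ∀ (r : ℂ[X]) (α : ℂ), α = 1 ∨ α = -1 →
        AnalyticAt ℂ (fun s => r.eval s * dx s) α := fun r α hα =>
      (AnalyticOnNhd.eval_polynomial r α trivial).mul (analyticAt_dx hα)
    simp only [eval_add, add_mul, mul_add]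
    rw [polarFunctional_add (hA p) (hA q), hp, hq, applyShift_add]
    ring
  | monomial n c =>
    have h1 : (1 - X ^ 2) * monomial n c = monomial n c + monomial (n + 2) (-c) := by
      rw [← C_mul_X_pow_eq_monomial, ← C_mul_X_pow_eq_monomial, C_neg]
      ring
    have h2 : polarFunctional K d (fun s => (monomial n c).eval s * dx s) =
        polarFunctional K d fun s => c * s ^ (-(-(n : ℤ) - 1) - 1) +
          (-c) * s ^ (-(1 - (n : ℤ)) - 1) := by
      refine polarFunctional_congr_of_eventuallyEq fun α hα => ?_
      have hα0 : α ≠ 0 := by rcases hα with rfl | rfl <;> norm_num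
      filter_upwards [eventually_ne_nhds hα0, dx_eventuallyEq hα0] with s hs hdx
      -- The exponents n and n - 2 of s^n dx/ds are put in the form -b - 1, with b = -n - 1 and b =
      -- 1 - n.
      have e1 : -(-(n : ℤ) - 1) - 1 = n := by ring
      have e2 : -(1 - (n : ℤ)) - 1 = n + (-2) := by ring
      rw [hdx, eval_monomial, e1, e2, zpow_add₀ hs, zpow_natCast]
      ring
    rw [h1, h2, polarFunctional_add (fun α hα => analyticAt_const_mul_zpow hα _ _)
      (fun α hα => analyticAt_const_mul_zpow hα _ _), polarFunctional_const_mul,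
      polarFunctional_const_mul, applyShift_add, applyShift_monomial, applyShift_monomial]
    have h3 := hN (-1 + n)
    have h4 := hN (-1 + ((n + 2 : ℕ) : ℤ))
    have e3 : -(-1 + (n : ℤ)) = 1 - n := by ring
    have e4 : -(-1 + ((n + 2 : ℕ) : ℤ)) = -n - 1 := by push_cast; ring
    rw [e3] at h3
    rw [e4] at h4
    rw [← h3, ← h4]
    simp only [polarQuasiPolynomial]
    ring

theorem iteratedDeriv_eval (p : ℂ[X]) (k : ℕ) :
    iteratedDeriv k (fun s => p.eval s) = fun s => (derivative^[k] p).eval s := by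
  induction k with
  | zero => simp
  | succ k ih =>
    rw [iteratedDeriv_succ, ih, Function.iterate_succ_apply']
    funext s
    exact Polynomial.deriv _

/-- The functional uses derivatives of order below K only, and by Leibniz's rule these involve only
derivatives of y that `partialSum y M` reproduces. -/
theorem polarFunctional_mul_dx_eq_partialSum {K M : ℕ} (d : ℂ → ℕ → ℂ) {y : ℂ → ℂ}
    (h₁ : AnalyticAt ℂ y 1) (h₂ : AnalyticAt ℂ y (-1)) (hM : K ≤ M) :
    polarFunctional K d (fun s => y s * dx s)
      = polarFunctional K d fun s => (partialSum y M).eval s * dx s := by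
  refine polarFunctional_congr fun α hα i hi => ?_
  have hy : AnalyticAt ℂ y α := by rcases hα with rfl | rfl <;> assumption
  rw [iteratedDeriv_fun_mul hy.contDiffAt (analyticAt_dx hα).contDiffAt,
    iteratedDeriv_fun_mul (AnalyticOnNhd.eval_polynomial _ α trivial).contDiffAt
      (analyticAt_dx hα).contDiffAt]
  refine Finset.sum_congr rfl fun j hj => ?_
  have := Finset.mem_range.mp hj
  rw [iteratedDeriv_eval, ← partialSum_agrees y M j (by omega) α hα]

/-- Allowing p to be y itself when y is polynomial yields the monomial case directly, without
identifying its partial sums. -/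
theorem exists_forall_symplecticInvariant_eq {y : ℂ → ℂ} (h₁ : AnalyticAt ℂ y 1)
    (h₂ : AnalyticAt ℂ y (-1)) {g : ℕ} (hg : 1 ≤ g) : ∃ (K : ℕ) (N : ℤ → ℂ), IsN y g N ∧
      ∀ Φ, IsLocalPrimitive y Φ → ∀ p : ℂ[X],
        ((fun s => p.eval s) = y ∨ ∃ M, K ≤ M ∧ p = partialSum y M) →
          symplecticInvariant y Φ g =
            1 / (2 - 2 * (g : ℂ)) * applyShift ((1 - X ^ 2) * p) N (-1) := by
  obtain ⟨K, d, hω, hsym⟩ := exists_polar_form h₁ h₂ hg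
  have hN := polarQuasiPolynomial_neg hsym
  refine ⟨K, polarQuasiPolynomial K d, isN_polarQuasiPolynomial hω, fun Φ hΦ p hp => ?_⟩
  have h : polarFunctional K d (fun s => y s * dx s)
      = -applyShift ((1 - X ^ 2) * p) (polarQuasiPolynomial K d) (-1) := by
    rw [← polarFunctional_polynomial_mul_dx hN]
    rcases hp with rfl | ⟨M, hM, rfl⟩
    · rfl
    · exact polarFunctional_mul_dx_eq_partialSum d h₁ h₂ hM
  rw [symplecticInvariant, sum_residue_mul_omega hω hΦ, h, ← neg_sub (2 * (g : ℂ)) 2, one_div,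
    inv_neg, div_eq_mul_inv]
  ring

end EynardOrantin

end

/-! ### The two formulas for F^g -/

theorem mainTheorem5 :
    (∀ y : ℂ → ℂ, AnalyticAt ℂ y 1 → AnalyticAt ℂ y (-1) → deriv y 1 ≠ 0 → deriv y (-1) ≠ 0 →
      ∀ g : ℕ, 2 ≤ g →
        (∃! N : ℤ → ℂ, EynardOrantin.IsN y g N) ∧
        ∀ N : ℤ → ℂ, EynardOrantin.IsN y g N →
          ∀ Φ : ℂ → ℂ, EynardOrantin.IsLocalPrimitive y Φ →
            ∀ᶠ M : ℕ in atTop,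
              EynardOrantin.symplecticInvariant y Φ g =
                1 / (2 - 2 * (g : ℂ)) *
                  EynardOrantin.applyShift
                    ((1 - X ^ 2) * EynardOrantin.partialSum y M) N (-1)) ∧
    (∀ m : ℕ, 1 ≤ m → ∀ g : ℕ, 2 ≤ g →
      ∀ N : ℤ → ℂ, EynardOrantin.IsN (fun z => z ^ m / (m : ℂ)) g N →
        ∀ Φ : ℂ → ℂ, EynardOrantin.IsLocalPrimitive (fun z => z ^ m / (m : ℂ)) Φ →
          EynardOrantin.symplecticInvariant (fun z => z ^ m / (m : ℂ)) Φ g =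
            (N ((m : ℤ) + 1) - N ((m : ℤ) - 1)) / ((m : ℂ) * (2 * (g : ℂ) - 2))) := by
  refine ⟨fun y h₁ h₂ _ _ g hg => ?_, fun m hm g hg N hN Φ hΦ => ?_⟩
  · obtain ⟨K, N₀, hN₀, hF⟩ :=
      EynardOrantin.exists_forall_symplecticInvariant_eq h₁ h₂ (g := g) (by omega)
    refine ⟨⟨N₀, hN₀, fun N hN => hN.unique hN₀⟩, fun N hN Φ hΦ => ?_⟩
    obtain rfl := hN.unique hN₀
    filter_upwards [eventually_ge_atTop K] with M hM
    exact hF Φ hΦ _ (Or.inr ⟨M, hM, rfl⟩)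
  · have hA : ∀ α : ℂ, AnalyticAt ℂ (fun z : ℂ => z ^ m / (m : ℂ)) α := fun α => by
      simp only [div_eq_mul_inv]
      fun_prop
    obtain ⟨K, N₀, hN₀, hF⟩ :=
      EynardOrantin.exists_forall_symplecticInvariant_eq (hA 1) (hA (-1)) (g := g) (by omega)
    obtain rfl := hN.unique hN₀
    have hp : (1 - X ^ 2) * monomial m (m : ℂ)⁻¹
        = monomial m (m : ℂ)⁻¹ + monomial (m + 2) (-(m : ℂ)⁻¹) := by
      rw [← C_mul_X_pow_eq_monomial, ← C_mul_X_pow_eq_monomial, C_neg]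
      ring
    -- Here y is the polynomial z^m/m, so the shift expression has only the two terms N(m-1)/m and
    -- -N(m+1)/m.
    rw [hF Φ hΦ (monomial m (m : ℂ)⁻¹) (Or.inl (by
      funext s
      rw [eval_monomial, div_eq_inv_mul])), hp, EynardOrantin.applyShift_add,
      EynardOrantin.applyShift_monomial, EynardOrantin.applyShift_monomial]
    have e1 : (-1 : ℤ) + m = m - 1 := by ring
    have e2 : (-1 : ℤ) + ((m + 2 : ℕ) : ℤ) = m + 1 := by push_cast; ring
    rw [e1, e2, ← neg_sub (2 * (g : ℂ)) 2, one_div, inv_neg, div_eq_mul_inv, mul_inv]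
    ring
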